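/- There is a universal constant $C>0$ such that the following holds for every $n\ge 1$. Call $K\subset\mathbb{R}^n$ a convex body if it is compact and convex, has non-empty interior, and $K=-K$. Write $\|x\|_K=\inf\{t>0 : x\in tK\}$ for its norm and $X_K=(\mathbb{R}^n,\|\cdot\|_K)$. The body $K$ is in isotropic position if $\int_K\langle x,\theta\rangle^2\,dx$ is the same for all $\theta$ in the Euclidean unit sphere $S^{n-1}$. The isotropic constant $L_K\ge 0$ of $K$ is given by $L_K^2=\int_{T(K)}\langle x,\theta\rangle^2\,dx$ for all $\theta\in S^{n-1}$, where $T(K)$, with $T$ an invertible linear map, is in isotropic position and has volume $1$; such $T$ exist and $L_K$ does not depend on the choice of $T$. The Gaussian type-2 constant $T_2(X_K)$ is the least $T>0$ such that $$\Big(\mathbb{E}\,\Big\|\sum_{i=1}^m g_i x_i\Big\|_K^2\Big)^{1/2}\le T\,\Big(\sum_{i=1}^m\|x_i\|_K^2\Big)^{1/2}$$ for all $m\ge1$ and $x_1,\dots,x_m\in\mathbb{R}^n$, where $g_1,\dots,g_m$ are independent standard Gaussian random variables. Let $M_2(K)=\big(\int_{S^{n-1}}\|\theta\|_K^2\,d\sigma(\theta)\big)^{1/2}$,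 where $\sigma$ is the rotation invariant probability measure on $S^{n-1}$. The body $K$ is in Löwner's minimal volume outer ellipsoid position if some Euclidean ball centred at the origin contains $K$ and has the least volume among all ellipsoids (centred at the origin) that contain $K$. Theorem. Let $K$ be a convex body in $\mathbb{R}^n$. Then $$L_K\le C\,\inf\left\{T_2(X_L)\left(\frac{\mathrm{Vol}(L)}{\mathrm{Vol}(K)}\right)^{1/n} : L\supseteq K \text{ is a convex body in }\mathbb{R}^n\right\}.$$ If moreover $\mathrm{Vol}(K)=1$ and $K$ is in Löwner's minimal volume outer ellipsoid position or in isotropic position, then $$L_K\le C\,\frac{T_2(X_K)}{\sqrt n\,M_2(K)}.$$ -/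

import Mathlib

open MeasureTheory ProbabilityTheory Metric

noncomputable section

namespace SlicingType2

/-- `ℝⁿ` with its standard Euclidean structure. -/
abbrev E (n : ℕ) : Type := EuclideanSpace ℝ (Fin n)

/-- A (centrally symmetric) convex body in `ℝⁿ`: a compact convex set with non-empty interior
and `K = -K`. -/
structure IsSymmConvexBody {n : ℕ} (K : Set (E n)) : Prop where
  convex : Convex ℝ K
  isCompact : IsCompact K
  nonempty_interior : (interior K).Nonempty
  symm : ∀ x ∈ K, -x ∈ K

/-- The set `K` satisfies `∫_K ⟨x, θ⟩² dx = c` for all `θ` in the Euclidean unit sphere. -/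
def IsIsotropicWith {n : ℕ} (K : Set (E n)) (c : ℝ) : Prop :=
  ∀ θ : E n, ‖θ‖ = 1 → ∫ x in K, (inner ℝ x θ) ^ 2 = c

/-- `K` is in isotropic position: `∫_K ⟨x, θ⟩² dx` does not depend on the unit vector `θ`. -/
def IsIsotropicPosition {n : ℕ} (K : Set (E n)) : Prop :=
  ∃ c : ℝ, IsIsotropicWith K c

/-- `ℓ ≥ 0` is the isotropic constant of some linear image of `K` that has volume `1` and is in
isotropic position. For a convex body `K` there is exactly one such `ℓ`
(`existsUnique_hasIsotropicConstant`). -/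
def HasIsotropicConstant {n : ℕ} (K : Set (E n)) (ℓ : ℝ) : Prop :=
  0 ≤ ℓ ∧ ∃ T : E n ≃L[ℝ] E n, volume (T '' K) = 1 ∧ IsIsotropicWith (T '' K) (ℓ ^ 2)

/-- The isotropic constant `L_K`: the isotropic constant of `K` in its isotropic position of
volume `1`. For a convex body the set below is a singleton. -/
def isotropicConstant {n : ℕ} (K : Set (E n)) : ℝ :=
  sSup {ℓ : ℝ | HasIsotropicConstant K ℓ}

/-- The Gaussian type-2 inequality with constant `T` for the space `X_K = (ℝⁿ, ‖·‖_K)`, whose norm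
is the gauge of `K`. The coordinates of `g` are independent standard Gaussian variables. -/
def HasGaussianTypeTwo {n : ℕ} (K : Set (E n)) (T : ℝ) : Prop :=
  ∀ (m : ℕ) (x : Fin m → E n),
    √(∫ g : Fin m → ℝ, (gauge K (∑ i, g i • x i)) ^ 2 ∂(Measure.pi fun _ => gaussianReal 0 1))
      ≤ T * √(∑ i, (gauge K (x i)) ^ 2)

/-- The Gaussian type-2 constant `T₂(X_K)`: the least `T > 0` in the type-2 inequality. -/
def typeTwoConstant {n : ℕ} (K : Set (E n)) : ℝ :=
  sInf {T : ℝ | 0 < T ∧ HasGaussianTypeTwo K T}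

/-- `M₂(K) = (∫_{S^{n-1}} ‖θ‖_K² dσ(θ))^{1/2}`, with `σ` the rotation invariant probability measure
on the unit sphere (the average is taken with respect to surface measure). -/
def meanNormTwo {n : ℕ} (K : Set (E n)) : ℝ :=
  √(⨍ θ : sphere (0 : E n) 1, (gauge K (θ : E n)) ^ 2 ∂(volume : Measure (E n)).toSphere)

/-- An ellipsoid (centred at the origin): the image of the Euclidean unit ball under an invertible
linear map. -/
def IsEllipsoid {n : ℕ} (S : Set (E n)) : Prop :=
  ∃ T : E n ≃L[ℝ] E n, S = T '' closedBall (0 : E n) 1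

/-- `K` is in Löwner's minimal volume outer ellipsoid position: some Euclidean ball `r D_n`
contains `K` and has the least volume among all ellipsoids containing `K`. -/
def IsLownerPosition {n : ℕ} (K : Set (E n)) : Prop :=
  ∃ r : ℝ, 0 < r ∧ K ⊆ closedBall (0 : E n) r ∧
    ∀ S : Set (E n), IsEllipsoid S → K ⊆ S → volume (closedBall (0 : E n) r) ≤ volume S

/-- The volume ratio `(Vol L / Vol K)^{1/n}`. -/
def volRatio {n : ℕ} (L K : Set (E n)) : ℝ :=
  (volume.real L / volume.real K) ^ (1 / (n : ℝ))

/-! The isotropic constant is well defined. -/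

theorem setIntegral_sq_image {n : ℕ} {K : Set (E n)} (hK : MeasurableSet K) (T : E n ≃L[ℝ] E n)
    (θ : E n) : ∫ y in T '' K, (inner ℝ y θ) ^ 2 =
      |(T : E n →L[ℝ] E n).det| *
        ∫ x in K, (inner ℝ x (ContinuousLinearMap.adjoint (T : E n →L[ℝ] E n) θ)) ^ 2 := by
  have h := integral_image_eq_integral_abs_det_fderiv_smul volume hK
    (fun x _ => (T : E n →L[ℝ] E n).hasFDerivAt.hasFDerivWithinAt) T.injective.injOn
    (fun y : E n => (inner ℝ y θ) ^ 2)
  simp only [smul_eq_mul, integral_const_mul] at h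
  simp only [ContinuousLinearMap.adjoint_inner_right]
  exact h

theorem volume_image {n : ℕ} (K : Set (E n)) (T : E n ≃L[ℝ] E n) :
    volume (T '' K) = ENNReal.ofReal |(T : E n →L[ℝ] E n).det| * volume K :=
  Measure.addHaar_image_continuousLinearMap volume (T : E n →L[ℝ] E n) K

theorem IsIsotropicWith.eq {n : ℕ} {K : Set (E n)} {c : ℝ} (h : IsIsotropicWith K c) (θ : E n) :
    ∫ x in K, (inner ℝ x θ) ^ 2 = c * ‖θ‖ ^ 2 := by
  rcases eq_or_ne θ 0 with rfl | h0
  · simp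
  · have h1 : ‖θ‖ ≠ 0 := norm_ne_zero_iff.2 h0
    have := h (‖θ‖⁻¹ • θ) (by rw [norm_smul, norm_inv, norm_norm, inv_mul_cancel₀ h1])
    simp only [inner_smul_right, mul_pow, integral_const_mul] at this
    rw [← this]
    field_simp

theorem IsSymmConvexBody.measurableSet {n : ℕ} {K : Set (E n)} (hK : IsSymmConvexBody K) :
    MeasurableSet K := hK.isCompact.isClosed.measurableSet

theorem IsSymmConvexBody.volume_pos {n : ℕ} {K : Set (E n)} (hK : IsSymmConvexBody K) :
    0 < volume K :=
  Measure.measure_pos_of_nonempty_interior volume hK.nonempty_interior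

theorem setIntegral_sq_pos {n : ℕ} {K : Set (E n)} (hK : IsSymmConvexBody K) {θ : E n}
    (hθ : θ ≠ 0) : 0 < ∫ x in K, inner ℝ x θ * inner ℝ x θ := by
  have hi : IntegrableOn (fun x : E n => inner ℝ x θ * inner ℝ x θ) K :=
    (by fun_prop : Continuous fun x : E n => inner ℝ x θ * inner ℝ x θ).continuousOn
      |>.integrableOn_compact hK.isCompact
  rw [setIntegral_pos_iff_support_of_nonneg_ae (Filter.Eventually.of_forall fun x =>
    mul_self_nonneg _) hi]
  have hz : volume ((ℝ ∙ θ)ᗮ : Set (E n)) = 0 := by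
    apply Measure.addHaar_submodule
    intro h
    have : θ ∈ (ℝ ∙ θ)ᗮ := h ▸ Submodule.mem_top
    exact hθ (inner_self_eq_zero.1 (Submodule.mem_orthogonal_singleton_iff_inner_left.1 this))
  have hs : (Function.support fun x : E n => inner ℝ x θ * inner ℝ x θ) ∩ K =
      K \ ((ℝ ∙ θ)ᗮ : Set (E n)) := by
    ext x
    simp only [Set.mem_inter_iff, Function.mem_support, Set.mem_sdiff, SetLike.mem_coe,
      Submodule.mem_orthogonal_singleton_iff_inner_left, ne_eq, mul_self_eq_zero]
    tauto
  rw [hs, measure_sdiff_null hz]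
  exact hK.volume_pos

/-- Some linear image of a convex body has volume `1` and is in isotropic position. -/
theorem exists_hasIsotropicConstant {n : ℕ} (hn : 1 ≤ n) {K : Set (E n)}
    (hK : IsSymmConvexBody K) : ∃ ℓ, HasIsotropicConstant K ℓ := by
  have hint : ∀ θ φ : E n, IntegrableOn (fun x : E n => inner ℝ x θ * inner ℝ x φ) K :=
    fun θ φ => (by fun_prop : Continuous fun x : E n => inner ℝ x θ * inner ℝ x φ).continuousOn
      |>.integrableOn_compact hK.isCompact
  let B : LinearMap.BilinForm ℝ (E n) := LinearMap.mk₂ ℝ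
    (fun θ φ => ∫ x in K, inner ℝ x θ * inner ℝ x φ)
    (fun a b c => by
      simp only [inner_add_right, add_mul]; exact integral_add (hint a c) (hint b c))
    (fun r a c => by simp only [inner_smul_right, mul_assoc, integral_const_mul, smul_eq_mul])
    (fun a b c => by
      simp only [inner_add_right, mul_add]; exact integral_add (hint a b) (hint a c))
    (fun r a c => by
      simp only [inner_smul_right, mul_left_comm, integral_const_mul, smul_eq_mul])
  have hB : ∀ θ φ, B θ φ = ∫ x in K, inner ℝ x θ * inner ℝ x φ := fun _ _ => rfl
  have hsymm : LinearMap.IsSymm B := ⟨fun a b => by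
    simp only [hB, mul_comm, RingHom.id_apply]⟩
  obtain ⟨v, hv⟩ := LinearMap.BilinForm.exists_orthogonal_basis (B := B) hsymm
  have hfr : Module.finrank ℝ (E n) = n := by simp
  let w : Module.Basis (Fin n) ℝ (E n) := v.reindex (finCongr hfr)
  have hw : ∀ i j, i ≠ j → B (w i) (w j) = 0 := by
    intro i j hij
    simp only [w, Module.Basis.reindex_apply]
    exact hv (fun h => hij ((finCongr hfr).symm.injective h))
  have hpos : ∀ i, 0 < B (w i) (w i) := fun i => setIntegral_sq_pos hK (w.ne_zero i)
  let e := (EuclideanSpace.basisFun (Fin n) ℝ)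
  let u : Module.Basis (Fin n) ℝ (E n) :=
    w.isUnitSMul (w := fun i => (√(B (w i) (w i)))⁻¹)
      (fun i => (inv_ne_zero (Real.sqrt_pos.2 (hpos i)).ne').isUnit)
  have hu : ∀ i j, B (u i) (u j) = if i = j then 1 else 0 := by
    intro i j
    simp only [u, Module.Basis.isUnitSMul_apply, map_smul, LinearMap.smul_apply, smul_eq_mul]
    split_ifs with h
    · subst h
      have := Real.mul_self_sqrt (hpos i).le
      have h2 := (Real.sqrt_pos.2 (hpos i)).ne'
      field_simp
      nlinarith
    · rw [hw i j h]; simp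
  let S : E n ≃L[ℝ] E n := (e.toBasis.equiv u (Equiv.refl _)).toContinuousLinearEquiv
  have hS : ∀ θ : E n, S θ = ∑ i, θ i • u i := by
    intro θ
    have : θ = ∑ i, θ i • e i := by
      conv_lhs => rw [← e.sum_repr θ]
      simp [e]
    conv_lhs => rw [this]
    rw [map_sum]
    refine Finset.sum_congr rfl fun i _ => ?_
    rw [map_smul]
    congr 1
    have := e.toBasis.equiv_apply i u (Equiv.refl _)
    simpa [S] using this
  have hBS : ∀ θ : E n, ∫ x in K, (inner ℝ x (S θ)) ^ 2 = ‖θ‖ ^ 2 := by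
    intro θ
    have h1 : ∫ x in K, (inner ℝ x (S θ)) ^ 2 = B (S θ) (S θ) := by simp only [hB, pow_two]
    rw [h1, hS]
    simp only [map_sum, map_smul, LinearMap.sum_apply, LinearMap.smul_apply, hu, smul_eq_mul]
    rw [EuclideanSpace.real_norm_sq_eq]
    simp [pow_two]
  have hvol : 0 < volume.real K :=
    ENNReal.toReal_pos hK.volume_pos.ne' hK.isCompact.measure_lt_top.ne
  let A : E n →L[ℝ] E n := ContinuousLinearMap.adjoint (S : E n →L[ℝ] E n)
  have hA : Function.Injective A := by
    rw [injective_iff_map_eq_zero]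
    intro x hx
    obtain ⟨y, hy⟩ := S.surjective x
    have h0 : inner ℝ (A x) y = 0 := by rw [hx, inner_zero_left]
    rw [ContinuousLinearMap.adjoint_inner_left] at h0
    have h1 : inner ℝ x x = 0 := by
      conv_lhs => rw [← hy]
      rw [← hy] at h0
      exact h0
    exact inner_self_eq_zero.1 h1
  let A' : E n ≃L[ℝ] E n := (LinearEquiv.ofInjectiveEndo (A : E n →ₗ[ℝ] E n) hA).toContinuousLinearEquiv
  have hA' : (A' : E n →L[ℝ] E n) = A := by ext; rfl
  have hdet : 0 < |A.det| := by
    rw [← hA']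
    exact abs_pos.2 A'.toLinearEquiv.isUnit_det'.ne_zero
  let d : ℝ := |A.det| * volume.real K
  have hd : 0 < d := by positivity
  let c : ℝ := (d⁻¹) ^ (1 / (n : ℝ))
  have hc : 0 < c := by positivity
  have hcn : c ^ n = d⁻¹ := by
    simp only [c, one_div]
    exact Real.rpow_inv_natCast_pow (by positivity) (by omega)
  let T : E n ≃L[ℝ] E n := A'.trans (ContinuousLinearEquiv.smulLeft (Units.mk0 c hc.ne'))
  have hT : (T : E n →L[ℝ] E n) = c • A := by ext; rfl
  have hTdet : |(T : E n →L[ℝ] E n).det| = c ^ n * |A.det| := by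
    rw [hT]
    simp only [ContinuousLinearMap.det, ContinuousLinearMap.toLinearMap_smul, LinearMap.det_smul,
      abs_mul, abs_pow, abs_of_pos hc, hfr]
  refine ⟨√(c ^ n * |A.det| * c ^ 2), Real.sqrt_nonneg _, T, ?_, ?_⟩
  · rw [volume_image, hTdet, ← ENNReal.ofReal_toReal hK.isCompact.measure_lt_top.ne,
      ← ENNReal.ofReal_mul (by positivity)]
    have : c ^ n * |A.det| * (volume K).toReal = 1 := by
      rw [hcn, mul_assoc]; exact inv_mul_cancel₀ hd.ne'
    rw [this, ENNReal.ofReal_one]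
  · intro θ hθ
    rw [setIntegral_sq_image hK.measurableSet, hTdet, hT, Real.sq_sqrt (by positivity)]
    simp only [map_smulₛₗ, A, ContinuousLinearMap.adjoint_adjoint, smul_apply,
      inner_smul_right, mul_pow, integral_const_mul]
    have := hBS θ
    simp only [ContinuousLinearEquiv.coe_coe] at this ⊢
    rw [this, hθ]
    simp

theorem hasIsotropicConstant_le {n : ℕ} (hn : 1 ≤ n) {K : Set (E n)}
    (hK : IsSymmConvexBody K) {ℓ₁ ℓ₂ : ℝ} (h₁ : HasIsotropicConstant K ℓ₁)
    (h₂ : HasIsotropicConstant K ℓ₂) : ℓ₁ ≤ ℓ₂ := by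
  obtain ⟨hl₁, T₁, hv₁, hi₁⟩ := h₁
  obtain ⟨hl₂, T₂, hv₂, hi₂⟩ := h₂
  have hm : MeasurableSet (T₁ '' K) :=
    (hK.isCompact.image T₁.continuous).isClosed.measurableSet
  let R : E n ≃L[ℝ] E n := T₁.symm.trans T₂
  have hR : R '' (T₁ '' K) = T₂ '' K := by
    rw [Set.image_image]; simp [R]
  have hdet : |(R : E n →L[ℝ] E n).det| = 1 := by
    have := volume_image (T₁ '' K) R
    rw [hR, hv₁, hv₂, mul_one] at this
    exact (ENNReal.ofReal_eq_one.1 this.symm)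
  let A : E n →L[ℝ] E n := ContinuousLinearMap.adjoint (R : E n →L[ℝ] E n)
  have hA : ∀ θ, ℓ₂ * ‖θ‖ = ℓ₁ * ‖A θ‖ := fun θ => by
    have h : ℓ₂ ^ 2 * ‖θ‖ ^ 2 = ℓ₁ ^ 2 * ‖A θ‖ ^ 2 := by
      rw [← hi₂.eq θ, ← hi₁.eq (A θ), ← hR, setIntegral_sq_image hm R θ, hdet, one_mul]
    rw [← mul_pow, ← mul_pow] at h
    exact (pow_left_inj₀ (by positivity) (by positivity) two_ne_zero).1 h
  have hAdet : |A.det| = 1 := by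
    have h : A.det = (R : E n →L[ℝ] E n).det := by
      let b := EuclideanSpace.basisFun (Fin n) ℝ
      simp only [A, ContinuousLinearMap.det]
      rw [← LinearMap.det_toMatrix b.toBasis, ← LinearMap.det_toMatrix b.toBasis]
      have h2 := LinearMap.toMatrix_adjoint b b ((R : E n →L[ℝ] E n) : E n →ₗ[ℝ] E n)
      have h3 : ((ContinuousLinearMap.adjoint (R : E n →L[ℝ] E n) : E n →L[ℝ] E n) :
          E n →ₗ[ℝ] E n) = LinearMap.adjoint ((R : E n →L[ℝ] E n) : E n →ₗ[ℝ] E n) := rfl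
      rw [h3, h2, Matrix.det_conjTranspose]
      simp
    rw [h, hdet]
  by_contra! hlt
  have hl : 0 < ℓ₁ := hl₂.trans_lt hlt
  have hvol := Measure.addHaar_image_continuousLinearMap volume A (closedBall (0 : E n) 1)
  rw [hAdet, ENNReal.ofReal_one, one_mul] at hvol
  have hsub : A '' closedBall (0 : E n) 1 ⊆ closedBall (0 : E n) (ℓ₂ / ℓ₁) := by
    rintro _ ⟨θ, hθ, rfl⟩
    rw [mem_closedBall_zero_iff] at hθ ⊢
    rw [le_div_iff₀ hl, mul_comm, ← hA θ]
    exact mul_le_of_le_one_right hl₂ hθ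
  have hle := measure_mono (μ := volume) hsub
  rw [hvol, Measure.addHaar_closedBall volume _ (by positivity : 0 ≤ ℓ₂ / ℓ₁),
    Measure.addHaar_closedBall volume _ zero_le_one, one_pow, ENNReal.ofReal_one, one_mul,
    finrank_euclideanSpace_fin] at hle
  have hb0 : volume (ball (0 : E n) 1) ≠ 0 := (measure_ball_pos volume _ one_pos).ne'
  have hbt : volume (ball (0 : E n) 1) ≠ ⊤ := measure_ball_lt_top.ne
  have hr : (ℓ₂ / ℓ₁) ^ n < 1 :=
    pow_lt_one₀ (by positivity) ((div_lt_one hl).2 hlt) (by omega)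
  have : ENNReal.ofReal ((ℓ₂ / ℓ₁) ^ n) * volume (ball (0 : E n) 1) <
      1 * volume (ball (0 : E n) 1) :=
    ENNReal.mul_lt_mul_left hb0 hbt (by simpa using hr)
  rw [one_mul] at this
  exact absurd hle (not_le.2 this)

/-- The isotropic constant exists and does not depend on the isotropic position chosen. -/
theorem existsUnique_hasIsotropicConstant {n : ℕ} (hn : 1 ≤ n) {K : Set (E n)}
    (hK : IsSymmConvexBody K) : ∃! ℓ, HasIsotropicConstant K ℓ := by
  obtain ⟨ℓ, hl⟩ := exists_hasIsotropicConstant hn hK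
  exact ⟨ℓ, hl, fun ℓ' hl' => le_antisymm (hasIsotropicConstant_le hn hK hl' hl)
    (hasIsotropicConstant_le hn hK hl hl')⟩

theorem hasIsotropicConstant_isotropicConstant {n : ℕ} (hn : 1 ≤ n) {K : Set (E n)}
    (hK : IsSymmConvexBody K) : HasIsotropicConstant K (isotropicConstant K) := by
  obtain ⟨ℓ, hl, hu⟩ := existsUnique_hasIsotropicConstant hn hK
  have : {ℓ : ℝ | HasIsotropicConstant K ℓ} = {ℓ} :=
    Set.eq_singleton_iff_unique_mem.2 ⟨hl, hu⟩
  rw [isotropicConstant, this, csSup_singleton]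
  exact hl

end SlicingType2

end

open SlicingType2

namespace SlicingType2

/-! ### Compact convex hulls and the Gaussian measure -/

/-! The type-2 inequality is tested on a decomposition of the identity. If `∑ wᵢ xᵢ ⊗ xᵢ = s² Id`
with probability weights and `‖xᵢ‖_K ≤ 1`, then `∑ gᵢ √wᵢ xᵢ` has the law of `s G`, with `G`
standard Gaussian, so `s (E‖G‖_K²)^{1/2} ≤ T₂(X_K)` (`HasGaussianTypeTwo.mul_sqrt_le`). Polar
coordinates give `E‖G‖_K² = n M₂(K)²`.

If `K` is isotropic of volume 1, its covariance `L_K² Id` is an average of `x ⊗ x` over `K`, hence a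
finite convex combination of such matrices; thus `s = L_K` is available. For `L ⊇ K`, the same
points, taken in the isotropic position `T K`, have norm at most 1 for `T L`, and a small-ball
estimate bounds `E‖G‖²` below by the volume radius of `T L`.

In Löwner position John's theorem supplies contact points with `s = r / √n`, and `L_K ≤ r / √n`
because a volume-preserving linear change from isotropic position cannot lower `∫_K |x|²`. -/

theorem isCompact_convexHull_of_finiteDimensional {V : Type*} [NormedAddCommGroup V]
    [NormedSpace ℝ V] [FiniteDimensional ℝ V] {S : Set V} (hS : IsCompact S) :
    IsCompact (convexHull ℝ S) := by
  classical
  rcases S.eq_empty_or_nonempty with rfl | ⟨s₀, hs₀⟩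
  · simp
  -- By Carathéodory, `d` points suffice, so the hull is a continuous image of simplex × `S^d`.
  -- Shorter combinations are padded with weight 0 at the dummy point `s₀`.
  set d := Module.finrank ℝ V + 1 with hd
  have hc : IsCompact ((fun p : (Fin d → ℝ) × (Fin d → V) => ∑ i, p.1 i • p.2 i) ''
      (stdSimplex ℝ (Fin d) ×ˢ Set.univ.pi fun _ => S)) :=
    ((isCompact_stdSimplex ℝ (Fin d)).prod (isCompact_univ_pi fun _ => hS)).image
      (by fun_prop)
  convert hc using 1
  apply Set.Subset.antisymm
  · intro x hx
    obtain ⟨ι, _, z, w, hz, hai, hw, hw1, hx⟩ := eq_pos_convex_span_of_mem_convexHull hx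
    have hcard : Fintype.card ι ≤ Fintype.card (Fin d) := by
      rw [Fintype.card_fin]
      exact hai.card_le_finrank_succ.trans (Nat.succ_le_succ (Submodule.finrank_le _))
    obtain ⟨e⟩ := Function.Embedding.nonempty_of_card_le hcard
    have hei : ∀ (i : ι), ∀ (h : ∃ i', e i' = e i), h.choose = i :=
      fun i h => e.injective h.choose_spec
    refine ⟨(fun j => if h : ∃ i, e i = j then w h.choose else 0,
      fun j => if h : ∃ i, e i = j then z h.choose else s₀), ⟨⟨?_, ?_⟩, ?_⟩, ?_⟩
    · intro j
      dsimp only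
      split_ifs with h
      · exact (hw _).le
      · exact le_rfl
    · rw [← hw1]
      refine (Fintype.sum_of_injective e e.injective _ _
        (fun j (hj : ¬∃ i, e i = j) => by dsimp only; rw [dif_neg hj]) (fun i => ?_)).symm
      have h : ∃ i', e i' = e i := ⟨i, rfl⟩
      simp only [dif_pos h, hei i h]
    · intro j _
      dsimp only
      split_ifs with h
      · exact hz ⟨_, rfl⟩
      · exact hs₀
    · rw [← hx]
      refine (Fintype.sum_of_injective e e.injective _ _
        (fun j (hj : ¬∃ i, e i = j) => by dsimp only; rw [dif_neg hj, zero_smul]) (fun i => ?_)).symm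
      have h : ∃ i', e i' = e i := ⟨i, rfl⟩
      simp only [dif_pos h, hei i h]
  · rintro _ ⟨⟨w, z⟩, ⟨hw, hz⟩, rfl⟩
    exact mem_convexHull_of_exists_fintype w z hw.1 hw.2 (fun i => hz i trivial) rfl

/-- The density of the standard Gaussian measure on `ℝⁿ`. -/
noncomputable def gaussianDensity {n : ℕ} (x : E n) : ℝ :=
  (2 * Real.pi) ^ (-(n : ℝ) / 2) * Real.exp (-(1 / 2) * ‖x‖ ^ 2)

theorem gaussianDensity_nonneg {n : ℕ} (x : E n) : 0 ≤ gaussianDensity x := by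
  unfold gaussianDensity; positivity

theorem continuous_gaussianDensity {n : ℕ} : Continuous (gaussianDensity (n := n)) := by
  unfold gaussianDensity; fun_prop

theorem integral_rexp_neg_half_norm_sq (n : ℕ) :
    ∫ x : E n, Real.exp (-(1 / 2) * ‖x‖ ^ 2) = (2 * Real.pi) ^ ((n : ℝ) / 2) := by
  rw [GaussianFourier.integral_rexp_neg_mul_sq_norm (by norm_num : (0 : ℝ) < 1 / 2)]
  rw [finrank_euclideanSpace_fin]
  congr 1
  ring

theorem integrable_gaussianDensity {n : ℕ} : Integrable (gaussianDensity (n := n)) := by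
  unfold gaussianDensity
  apply Integrable.const_mul
  -- A non-integrable function has Bochner integral 0, so a nonzero value certifies integrability.
  apply Integrable.of_integral_ne_zero
  rw [integral_rexp_neg_half_norm_sq]
  positivity

/-- Both sides have the same characteristic function. The density is what gives access to Lebesgue
volume and to polar coordinates. -/
theorem stdGaussian_eq_withDensity (n : ℕ) :
    stdGaussian (E n) = volume.withDensity fun x => ENNReal.ofReal (gaussianDensity x) := by
  have hfin : IsFiniteMeasure
      ((volume : Measure (E n)).withDensity fun x => ENNReal.ofReal (gaussianDensity x)) :=
    isFiniteMeasure_withDensity_ofReal integrable_gaussianDensity.2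
  apply Measure.ext_of_charFun
  ext t
  rw [charFun_stdGaussian, charFun_apply, integral_withDensity_eq_integral_toReal_smul
    (by have := continuous_gaussianDensity (n := n); fun_prop)
    (Filter.Eventually.of_forall fun _ => ENNReal.ofReal_lt_top)]
  have h := GaussianFourier.integral_cexp_neg_mul_sq_norm_add (V := E n) (b := 1 / 2)
    (by norm_num) Complex.I t
  have h2 : ∀ x : E n, (ENNReal.ofReal (gaussianDensity x)).toReal •
      Complex.exp (inner ℝ x t * Complex.I) = ((2 * Real.pi) ^ (-(n : ℝ) / 2) : ℝ) *
        Complex.exp (-(1 / 2) * ‖x‖ ^ 2 + Complex.I * inner ℝ t x) := by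
    intro x
    rw [ENNReal.toReal_ofReal (gaussianDensity_nonneg x), gaussianDensity, Complex.exp_add,
      Complex.real_smul, real_inner_comm]
    push_cast
    ring_nf
  simp_rw [h2]
  rw [integral_const_mul, h, finrank_euclideanSpace_fin, ← mul_assoc]
  have h3 : (((2 * Real.pi) ^ (-(n : ℝ) / 2) : ℝ) : ℂ) *
      (Real.pi / (1 / 2) : ℂ) ^ ((n : ℂ) / 2) = 1 := by
    have : (Real.pi / (1 / 2) : ℂ) ^ ((n : ℂ) / 2) = (((2 * Real.pi) ^ ((n : ℝ) / 2) : ℝ) : ℂ) := by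
      rw [Complex.ofReal_cpow (by positivity)]
      push_cast
      congr 1
      ring
    rw [this, ← Complex.ofReal_mul, ← Real.rpow_add (by positivity)]
    simp [neg_div]
  rw [h3, one_mul]
  congr 1
  rw [Complex.I_sq]
  ring

theorem integral_stdGaussian {n : ℕ} (f : E n → ℝ) :
    ∫ x, f x ∂(stdGaussian (E n)) = ∫ x, gaussianDensity x * f x := by
  rw [stdGaussian_eq_withDensity, integral_withDensity_eq_integral_toReal_smul
    (by have := continuous_gaussianDensity (n := n); fun_prop)
    (Filter.Eventually.of_forall fun _ => ENNReal.ofReal_lt_top)]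
  simp only [ENNReal.toReal_ofReal (gaussianDensity_nonneg _), smul_eq_mul]

theorem stdGaussian_le {n : ℕ} (S : Set (E n)) :
    stdGaussian (E n) S ≤ ENNReal.ofReal ((2 * Real.pi) ^ (-(n : ℝ) / 2)) * volume S := by
  rw [stdGaussian_eq_withDensity, withDensity_apply', ← setLIntegral_const]
  apply lintegral_mono
  intro x
  apply ENNReal.ofReal_le_ofReal
  unfold gaussianDensity
  apply mul_le_of_le_one_right (by positivity)
  rw [Real.exp_le_one_iff]
  nlinarith [sq_nonneg ‖x‖]

/-- The second moment of a linear functional of independent standard Gaussians. -/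
theorem integral_sum_mul_sq {m : ℕ} (c : Fin m → ℝ) :
    ∫ g : Fin m → ℝ, (∑ i, g i * c i) ^ 2 ∂(Measure.pi fun _ => gaussianReal 0 1) =
      ∑ i, c i ^ 2 := by
  let L : StrongDual ℝ (E m) := innerSL ℝ (WithLp.toLp 2 c)
  have h := variance_dual_stdGaussian (E := E m) L
  rw [variance_of_integral_eq_zero (by fun_prop) (integral_strongDual_stdGaussian L),
    ← map_pi_eq_stdGaussian, integral_map (by fun_prop) (by fun_prop)] at h
  have hn : ‖L‖ ^ 2 = ∑ i, c i ^ 2 := by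
    rw [innerSL_apply_norm, EuclideanSpace.real_norm_sq_eq]
  rw [← hn, ← h]
  congr 1

theorem integral_norm_sq_stdGaussian (n : ℕ) :
    ∫ x, ‖x‖ ^ 2 ∂(stdGaussian (E n)) = n := by
  have h : ∀ i : Fin n, ∫ x, (x i) ^ 2 ∂(stdGaussian (E n)) = 1 := by
    intro i
    have := integral_sum_mul_sq (Pi.single i (1 : ℝ))
    rw [← map_pi_eq_stdGaussian, integral_map (by fun_prop) (by fun_prop)]
    simpa [Pi.single_apply] using this
  simp_rw [EuclideanSpace.real_norm_sq_eq]
  rw [integral_finsetSum]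
  · simp [h]
  · intro i _
    exact Integrable.of_integral_ne_zero (by rw [h i]; norm_num)

/-- A Gaussian combination of vectors with covariance `s² Id` is `s` times a standard Gaussian
vector. -/
theorem map_sum_smul_pi_gaussianReal {n : ℕ} {ι : Type*} [Fintype ι] (x : ι → E n) (s : ℝ)
    (h : ∀ t : E n, ∑ i, (inner ℝ (x i) t) ^ 2 = s ^ 2 * ‖t‖ ^ 2) :
    (Measure.pi fun _ : ι => gaussianReal 0 1).map (fun g => ∑ i, g i • x i) =
      (stdGaussian (E n)).map (fun y => s • y) := by
  have hf : Measurable fun g : ι → ℝ => ∑ i, g i • x i := by fun_prop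
  have := Measure.isProbabilityMeasure_map (μ := Measure.pi fun _ : ι => gaussianReal 0 1)
    hf.aemeasurable
  have := Measure.isProbabilityMeasure_map (μ := stdGaussian (E n)) (f := fun y => s • y)
    (by fun_prop)
  apply Measure.ext_of_charFun
  ext t
  rw [charFun_map_smul, charFun_stdGaussian, charFun_apply, integral_map hf.aemeasurable
    (by fun_prop)]
  -- By independence the characteristic function is a product of factors `exp(-⟨xᵢ, t⟩² / 2)`; `h`
  -- evaluates the sum of the exponents.
  simp_rw [sum_inner, Complex.ofReal_sum, Finset.sum_mul, Complex.exp_sum,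
    integral_fintype_prod_eq_prod
      (f := fun i (y : ℝ) => Complex.exp ((inner ℝ (y • x i) t : ℝ) * Complex.I)),
    real_inner_smul_left, mul_comm _ (inner ℝ (x _) t), Complex.ofReal_mul,
    ← charFun_apply_real, charFun_gaussianReal]
  rw [← Complex.exp_sum]
  congr 1
  have h' : ((∑ i, (inner ℝ (x i) t) ^ 2 : ℝ) : ℂ) = ((s ^ 2 * ‖t‖ ^ 2 : ℝ) : ℂ) := by rw [h t]
  rw [norm_smul, Real.norm_eq_abs]
  push_cast at h' ⊢
  simp only [mul_zero, zero_mul, one_mul, zero_sub, Finset.sum_neg_distrib, ← Finset.sum_div]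
  rw [h', mul_pow, ← Complex.ofReal_pow |s|, sq_abs]
  push_cast
  ring

/-! ### The gauge of a symmetric convex body -/

/-- The origin is the midpoint of an interior point and its reflection. -/
theorem IsSymmConvexBody.mem_nhds_zero {n : ℕ} {K : Set (E n)} (hK : IsSymmConvexBody K) :
    K ∈ nhds (0 : E n) := by
  obtain ⟨x, hx⟩ := hK.nonempty_interior
  have h := hK.convex.combo_interior_self_mem_interior hx (hK.symm x (interior_subset hx))
    (by norm_num : (0 : ℝ) < 1 / 2) (by norm_num : (0 : ℝ) ≤ 1 / 2) (by norm_num)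
  rw [smul_neg, add_neg_cancel] at h
  exact mem_interior_iff_mem_nhds.1 h

theorem IsSymmConvexBody.continuous_gauge {n : ℕ} {K : Set (E n)} (hK : IsSymmConvexBody K) :
    Continuous (gauge K) :=
  _root_.continuous_gauge hK.convex hK.mem_nhds_zero

theorem IsSymmConvexBody.exists_gauge_le {n : ℕ} {K : Set (E n)} (hK : IsSymmConvexBody K) :
    ∃ a : ℝ, 0 < a ∧ ∀ x, gauge K x ≤ a * ‖x‖ := by
  obtain ⟨r, hr, h⟩ := Metric.mem_nhds_iff.1 hK.mem_nhds_zero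
  refine ⟨r⁻¹, by positivity, fun x => ?_⟩
  rw [← div_eq_inv_mul, le_div_iff₀ hr, mul_comm]
  exact mul_gauge_le_norm h

theorem IsSymmConvexBody.exists_le_gauge {n : ℕ} {K : Set (E n)} (hK : IsSymmConvexBody K) :
    ∃ b : ℝ, 0 < b ∧ ∀ x, ‖x‖ ≤ b * gauge K x := by
  obtain ⟨b, hb, h⟩ := hK.isCompact.isBounded.subset_closedBall_lt 0 0
  refine ⟨b, hb, fun x => ?_⟩
  rw [mul_comm, ← div_le_iff₀ hb]
  exact le_gauge_of_subset_closedBall (absorbent_nhds_zero hK.mem_nhds_zero) hb.le h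

theorem gauge_image_equiv {n : ℕ} (A : E n ≃L[ℝ] E n) (K : Set (E n)) (x : E n) :
    gauge (A '' K) (A x) = gauge K x := by
  simp only [gauge_def', ← map_smul, A.injective.mem_set_image]

theorem gauge_sq_smul {n : ℕ} (K : Set (E n)) {t : ℝ} (ht : 0 ≤ t) (x : E n) :
    gauge K (t • x) ^ 2 = t ^ 2 * gauge K x ^ 2 := by
  rw [gauge_smul_of_nonneg ht, smul_eq_mul, mul_pow]

theorem IsSymmConvexBody.integrable_gauge_sq {n : ℕ} (hn : 1 ≤ n) {K : Set (E n)}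
    (hK : IsSymmConvexBody K) : Integrable (fun x => gauge K x ^ 2) (stdGaussian (E n)) := by
  obtain ⟨a, ha, h⟩ := hK.exists_gauge_le
  have hi : Integrable (fun x : E n => ‖x‖ ^ 2) (stdGaussian (E n)) :=
    Integrable.of_integral_ne_zero
      (by rw [integral_norm_sq_stdGaussian]; exact_mod_cast (by omega : n ≠ 0))
  refine (hi.const_mul (a ^ 2)).mono'
    (hK.continuous_gauge.pow 2).aestronglyMeasurable (Filter.Eventually.of_forall fun x => ?_)
  rw [Real.norm_of_nonneg (sq_nonneg _), ← mul_pow]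
  exact pow_le_pow_left₀ (gauge_nonneg x) (h x) 2

/-- The image of a symmetric convex body under a linear isomorphism. -/
theorem IsSymmConvexBody.image {n : ℕ} {K : Set (E n)} (hK : IsSymmConvexBody K)
    (A : E n ≃L[ℝ] E n) : IsSymmConvexBody (A '' K) where
  convex := hK.convex.linear_image (A : E n →ₗ[ℝ] E n)
  isCompact := hK.isCompact.image A.continuous
  nonempty_interior := by
    have h : A '' interior K = interior (A '' K) := A.toHomeomorph.image_interior K
    exact h ▸ hK.nonempty_interior.image _
  symm := by
    rintro _ ⟨x, hx, rfl⟩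
    exact ⟨-x, hK.symm x hx, map_neg A x⟩

/-! ### The Gaussian type-2 inequality -/

/-- `A` is an isometry from `X_K` onto `X_{A K}`, so bodies may be moved to isotropic position at no
cost. -/
theorem HasGaussianTypeTwo.image {n : ℕ} {K : Set (E n)} {T : ℝ} (h : HasGaussianTypeTwo K T)
    (A : E n ≃L[ℝ] E n) : HasGaussianTypeTwo (A '' K) T := by
  intro m x
  have hx : ∀ y, gauge (A '' K) y = gauge K (A.symm y) := fun y => by
    rw [← gauge_image_equiv A K (A.symm y), A.apply_symm_apply]
  simpa only [hx, map_sum, map_smul] using h m fun i => A.symm (x i)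

/-- The Gaussian type-2 inequality for vectors of norm at most one whose weighted covariance is a
multiple of the identity. -/
theorem HasGaussianTypeTwo.mul_sqrt_le {n : ℕ} {K : Set (E n)} (hK : IsSymmConvexBody K) {T : ℝ}
    (h : HasGaussianTypeTwo K T) (hT : 0 ≤ T) {m : ℕ} {w : Fin m → ℝ} {x : Fin m → E n}
    (hw : ∀ i, 0 ≤ w i) (hw1 : ∑ i, w i = 1) (hx : ∀ i, gauge K (x i) ≤ 1) {s : ℝ} (hs : 0 ≤ s)
    (hcov : ∀ t : E n, ∑ i, w i * (inner ℝ (x i) t) ^ 2 = s ^ 2 * ‖t‖ ^ 2) :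
    s * √(∫ y, gauge K y ^ 2 ∂(stdGaussian (E n))) ≤ T := by
  -- With the weights absorbed into the vectors, the right-hand sum is at most `∑ wᵢ = 1`.
  have h1 := h m fun i => √(w i) • x i
  have hlaw := map_sum_smul_pi_gaussianReal (fun i => √(w i) • x i) s (fun t => by
    rw [← hcov t]
    refine Finset.sum_congr rfl fun i _ => ?_
    rw [real_inner_smul_left, mul_pow, Real.sq_sqrt (hw i)])
  have hc : Measurable fun y => gauge K y ^ 2 := (hK.continuous_gauge.pow 2).measurable
  have h2 : ∫ g : Fin m → ℝ, gauge K (∑ i, g i • √(w i) • x i) ^ 2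
      ∂(Measure.pi fun _ => gaussianReal 0 1) =
      s ^ 2 * ∫ y, gauge K y ^ 2 ∂(stdGaussian (E n)) := by
    rw [← integral_map (φ := fun g : Fin m → ℝ => ∑ i, g i • √(w i) • x i)
      (f := fun y => gauge K y ^ 2) (Measurable.aemeasurable (by fun_prop)) hc.aestronglyMeasurable, hlaw,
      integral_map (by fun_prop) hc.aestronglyMeasurable]
    simp only [gauge_sq_smul K hs, integral_const_mul]
  rw [h2, Real.sqrt_mul (sq_nonneg s), Real.sqrt_sq hs] at h1
  refine h1.trans (mul_le_of_le_one_right hT ?_)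
  rw [Real.sqrt_le_one, ← hw1]
  refine Finset.sum_le_sum fun i _ => ?_
  rw [gauge_sq_smul K (Real.sqrt_nonneg _), Real.sq_sqrt (hw i)]
  exact mul_le_of_le_one_right (hw i) (pow_le_one₀ (gauge_nonneg _) (hx i))

/-- The Euclidean norm satisfies the type-2 identity with constant 1, and the gauge is equivalent to
it. Without this, `typeTwoConstant` could be the infimum of an empty set, which is 0 by default. -/
theorem IsSymmConvexBody.exists_hasGaussianTypeTwo {n : ℕ} {K : Set (E n)}
    (hK : IsSymmConvexBody K) : ∃ T, 0 < T ∧ HasGaussianTypeTwo K T := by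
  obtain ⟨a, ha, hga⟩ := hK.exists_gauge_le
  obtain ⟨b, hb, hgb⟩ := hK.exists_le_gauge
  refine ⟨a * b, by positivity, fun m x => ?_⟩
  set μ : Measure (Fin m → ℝ) := Measure.pi fun _ => gaussianReal 0 1
  have hcoord : ∀ k : Fin n, Integrable (fun g : Fin m → ℝ => (∑ i, g i * x i k) ^ 2) μ := by
    intro k
    have hL : MemLp (fun g : Fin m → ℝ => ∑ i, g i * x i k) 2 μ := by
      refine memLp_finsetSum _ fun i _ => ?_
      refine MemLp.mul_const ?_ _
      have := (measurePreserving_eval (fun _ : Fin m => gaussianReal 0 1) i)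
      exact (IsGaussian.memLp_two_id (μ := gaussianReal 0 1)).comp_measurePreserving this
    exact hL.integrable_sq
  have hnorm : ∀ g : Fin m → ℝ, ‖∑ i, g i • x i‖ ^ 2 = ∑ k, (∑ i, g i * x i k) ^ 2 := by
    intro g
    rw [EuclideanSpace.real_norm_sq_eq]
    simp
  have hint : ∫ g : Fin m → ℝ, ‖∑ i, g i • x i‖ ^ 2 ∂μ = ∑ i, ‖x i‖ ^ 2 := by
    simp_rw [hnorm, EuclideanSpace.real_norm_sq_eq]
    rw [integral_finsetSum _ fun k _ => hcoord k, Finset.sum_comm]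
    exact Finset.sum_congr rfl fun k _ => integral_sum_mul_sq fun i => x i k
  rw [show a * b = √((a * b) ^ 2) from (Real.sqrt_sq (by positivity)).symm,
    ← Real.sqrt_mul (by positivity)]
  apply Real.sqrt_le_sqrt
  calc ∫ g : Fin m → ℝ, gauge K (∑ i, g i • x i) ^ 2 ∂μ
      ≤ ∫ g : Fin m → ℝ, a ^ 2 * ‖∑ i, g i • x i‖ ^ 2 ∂μ := by
        refine integral_mono_of_nonneg (Filter.Eventually.of_forall fun _ => sq_nonneg _) ?_
          (Filter.Eventually.of_forall fun g => ?_)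
        · simp_rw [hnorm]
          exact (integrable_finsetSum _ fun k _ => hcoord k).const_mul _
        · dsimp only
          rw [← mul_pow]
          exact pow_le_pow_left₀ (gauge_nonneg _) (hga _) 2
    _ = a ^ 2 * ∑ i, ‖x i‖ ^ 2 := by rw [integral_const_mul, hint]
    _ ≤ a ^ 2 * ∑ i, b ^ 2 * gauge K (x i) ^ 2 := by
        gcongr with i
        rw [← mul_pow]
        exact pow_le_pow_left₀ (norm_nonneg _) (hgb _) 2
    _ = (a * b) ^ 2 * ∑ i, gauge K (x i) ^ 2 := by rw [← Finset.mul_sum]; ring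

theorem IsSymmConvexBody.le_typeTwoConstant {n : ℕ} {K : Set (E n)} (hK : IsSymmConvexBody K)
    {c : ℝ} (h : ∀ T, 0 < T → HasGaussianTypeTwo K T → c ≤ T) : c ≤ typeTwoConstant K :=
  le_csInf hK.exists_hasGaussianTypeTwo fun _ hT => h _ hT.1 hT.2

/-! ### Gaussian averages of the gauge -/

/-- Polar coordinates: the radial factor does not depend on `f`. -/
theorem integral_mul_norm_of_homogeneous {n : ℕ} (hn : 1 ≤ n) (f : E n → ℝ)
    (hf : ∀ t : ℝ, 0 ≤ t → ∀ x, f (t • x) = t ^ 2 * f x) (h : ℝ → ℝ) :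
    ∫ x, h ‖x‖ * f x = (∫ θ : sphere (0 : E n) 1, f θ ∂(volume : Measure (E n)).toSphere) *
      ∫ r : Set.Ioi (0 : ℝ), h r * (r : ℝ) ^ 2 ∂(Measure.volumeIoiPow (n - 1)) := by
  have : Nonempty (Fin n) := ⟨⟨0, hn⟩⟩
  rw [← integral_prod_mul]
  have hmp := Measure.measurePreserving_homeomorphUnitSphereProd (volume : Measure (E n))
  rw [finrank_euclideanSpace_fin] at hmp
  have hl : ∫ x, h ‖x‖ * f x = ∫ x : ({(0)}ᶜ : Set (E n)), h ‖(x : E n)‖ * f x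
      ∂((volume : Measure (E n)).comap (↑)) := by
    rw [integral_subtype_comap (measurableSet_singleton _).compl fun x : E n => h ‖x‖ * f x,
      restrict_compl_singleton]
  rw [← hmp.integral_comp (Homeomorph.measurableEmbedding _), hl]
  congr 1
  ext x
  have hx : ‖(x : E n)‖ ≠ 0 := norm_ne_zero_iff.2 x.2
  have h1 : f x = ‖(x : E n)‖ ^ 2 * f (‖(x : E n)‖⁻¹ • (x : E n)) := by
    rw [← hf _ (norm_nonneg _), smul_smul, mul_inv_cancel₀ hx, one_smul]
  simp only [homeomorphUnitSphereProd_apply_fst_coe, homeomorphUnitSphereProd_apply_snd_coe]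
  rw [h1]
  ring

/-- Comparison with `‖x‖²`, whose Gaussian integral is `n`, eliminates the radial integral without
computing it. -/
theorem integral_stdGaussian_of_homogeneous {n : ℕ} (hn : 1 ≤ n) (f : E n → ℝ)
    (hf : ∀ t : ℝ, 0 ≤ t → ∀ x, f (t • x) = t ^ 2 * f x) :
    ∫ x, f x ∂(stdGaussian (E n)) =
      n * ⨍ θ : sphere (0 : E n) 1, f θ ∂(volume : Measure (E n)).toSphere := by
  let h : ℝ → ℝ := fun r => (2 * Real.pi) ^ (-(n : ℝ) / 2) * Real.exp (-(1 / 2) * r ^ 2)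
  have hg : ∀ f' : E n → ℝ, ∫ x, f' x ∂(stdGaussian (E n)) = ∫ x, h ‖x‖ * f' x :=
    fun f' => integral_stdGaussian f'
  have h1 := integral_mul_norm_of_homogeneous hn f hf h
  have h2 := integral_mul_norm_of_homogeneous hn (fun x => ‖x‖ ^ 2)
    (fun t _ x => by rw [norm_smul, mul_pow, Real.norm_eq_abs, sq_abs]) h
  rw [← hg] at h1 h2
  rw [integral_norm_sq_stdGaussian] at h2
  simp only [norm_eq_of_mem_sphere, one_pow, integral_const, smul_eq_mul, mul_one] at h2
  have hσ : ((volume : Measure (E n)).toSphere).real Set.univ ≠ 0 := by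
    intro h0
    rw [h0, zero_mul] at h2
    have : (n : ℝ) ≠ 0 := by exact_mod_cast (by omega : n ≠ 0)
    exact this h2
  rw [h1, average_eq, smul_eq_mul, h2]
  field_simp

theorem sqrt_integral_gauge_sq_eq {n : ℕ} (hn : 1 ≤ n) (K : Set (E n)) :
    √(∫ x, gauge K x ^ 2 ∂(stdGaussian (E n))) = √(n : ℝ) * meanNormTwo K := by
  rw [meanNormTwo, ← Real.sqrt_mul (Nat.cast_nonneg n),
    ← integral_stdGaussian_of_homogeneous hn (fun x => gauge K x ^ 2)
      fun t ht x => gauge_sq_smul K ht x]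

open scoped Pointwise in
/-- The Gaussian average of a norm is bounded below by the volume radius of its unit ball. -/
theorem IsSymmConvexBody.one_le_volume_rpow_mul_sqrt_integral {n : ℕ} (hn : 1 ≤ n) {K : Set (E n)}
    (hK : IsSymmConvexBody K) :
    1 ≤ 2 * (volume.real K ^ (1 / (n : ℝ)) * √(∫ x, gauge K x ^ 2 ∂(stdGaussian (E n)))) := by
  have hn0 : (n : ℝ) ≠ 0 := by exact_mod_cast (by omega : n ≠ 0)
  set v := volume.real K
  have hv : 0 < v := ENNReal.toReal_pos hK.volume_pos.ne' hK.isCompact.measure_lt_top.ne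
  -- Chosen so that bounding the density by its value at 0 gives `t K` Gaussian measure at most `2⁻ⁿ
  -- ≤ 1/2`. Markov's inequality then yields `E‖G‖² ≥ t² / 2`.
  set t : ℝ := √(2 * Real.pi) * (1 / 2) * v ^ (-(1 / (n : ℝ))) with ht
  have ht0 : 0 < t := by positivity
  have htn : (2 * Real.pi) ^ (-(n : ℝ) / 2) * (t ^ n * v) = (1 / 2) ^ n := by
    rw [ht, mul_pow, mul_pow, ← Real.rpow_natCast (v ^ _), ← Real.rpow_mul hv.le,
      Real.sqrt_eq_rpow, ← Real.rpow_natCast ((2 * Real.pi) ^ _), ← Real.rpow_mul (by positivity)]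
    have e1 : -(1 / (n : ℝ)) * n = -1 := by field_simp
    have e2 : (1 / 2 : ℝ) * n = -(-(n : ℝ) / 2) := by ring
    rw [e1, e2, Real.rpow_neg_one, Real.rpow_neg (by positivity)]
    have : (2 * Real.pi) ^ (-(n : ℝ) / 2) ≠ 0 := by positivity
    field_simp
  have hset : {x | gauge K x < t} ⊆ t • K := by
    intro x hx
    have := setOfPred_gauge_lt_one_subset_self hK.convex (mem_of_mem_nhds hK.mem_nhds_zero)
      (absorbent_nhds_zero hK.mem_nhds_zero)
    rw [Set.mem_smul_set_iff_inv_smul_mem₀ ht0.ne']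
    apply this
    change gauge K (t⁻¹ • x) < 1
    rw [gauge_smul_of_nonneg (by positivity), smul_eq_mul, ← div_eq_inv_mul, div_lt_one ht0]
    exact hx
  have hsmall : (stdGaussian (E n)).real {x | gauge K x < t} ≤ 1 / 2 := by
    apply ENNReal.toReal_le_of_le_ofReal (by norm_num)
    refine (measure_mono hset).trans ((stdGaussian_le _).trans ?_)
    rw [Measure.addHaar_smul_of_nonneg _ ht0.le, finrank_euclideanSpace_fin,
      ← ENNReal.ofReal_toReal hK.isCompact.measure_lt_top.ne, ← ENNReal.ofReal_mul (by positivity),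
      ← ENNReal.ofReal_mul (by positivity)]
    apply ENNReal.ofReal_le_ofReal
    change (2 * Real.pi) ^ (-(n : ℝ) / 2) * (t ^ n * v) ≤ 1 / 2
    rw [htn]
    exact pow_le_of_le_one (by norm_num) (by norm_num) (by omega)
  have hmeas : MeasurableSet {x | gauge K x < t} :=
    measurableSet_lt hK.continuous_gauge.measurable measurable_const
  have hlarge : 1 / 2 ≤ (stdGaussian (E n)).real {x | t ^ 2 ≤ gauge K x ^ 2} := by
    have he : {x | t ^ 2 ≤ gauge K x ^ 2} = {x | gauge K x < t}ᶜ := by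
      ext x
      simp only [Set.mem_ofPred_eq, Set.mem_compl_iff, not_lt]
      exact pow_le_pow_iff_left₀ ht0.le (gauge_nonneg x) two_ne_zero
    rw [he, probReal_compl_eq_one_sub hmeas]
    linarith
  have hmarkov := mul_meas_ge_le_integral_of_nonneg
    (Filter.Eventually.of_forall fun x => sq_nonneg (gauge K x)) (hK.integrable_gauge_sq hn) (t ^ 2)
  set I := ∫ x, gauge K x ^ 2 ∂(stdGaussian (E n))
  have hI : t ^ 2 * (1 / 2) ≤ I := (mul_le_mul_of_nonneg_left hlarge (sq_nonneg t)).trans hmarkov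
  have hvt : v ^ (1 / (n : ℝ)) * t = √(2 * Real.pi) * (1 / 2) := by
    rw [ht, Real.rpow_neg hv.le]
    have : v ^ (1 / (n : ℝ)) ≠ 0 := by positivity
    field_simp
  -- The argument gives `π / 4`; the weaker `1 / 4` produces the constant 2.
  have hvI : 1 / 4 ≤ (v ^ (1 / (n : ℝ))) ^ 2 * I := by
    have h1 : (v ^ (1 / (n : ℝ)) * t) ^ 2 = Real.pi / 2 := by
      rw [hvt, mul_pow, Real.sq_sqrt (by positivity)]; ring
    have h2 := mul_le_mul_of_nonneg_left hI (sq_nonneg (v ^ (1 / (n : ℝ))))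
    nlinarith [Real.pi_gt_three]
  have hI0 : 0 ≤ I := integral_nonneg fun x => sq_nonneg _
  have hroot : 1 / 2 ≤ v ^ (1 / (n : ℝ)) * √I := by
    rw [← Real.sqrt_sq (by positivity : 0 ≤ v ^ (1 / (n : ℝ))), ← Real.sqrt_mul (sq_nonneg _)]
    apply Real.le_sqrt_of_sq_le
    linarith
  linarith

/-! ### Decompositions of the identity -/

/-- The matrix `x xᵀ`, as an array of coordinates. -/
def outerSq {n : ℕ} (x : E n) : Fin n × Fin n → ℝ := fun p => x p.1 * x p.2

theorem continuous_outerSq {n : ℕ} : Continuous (outerSq (n := n)) := by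
  unfold outerSq; fun_prop

/-- The matrix `c Id`, as an array of coordinates. -/
def scalarArray (n : ℕ) (c : ℝ) : Fin n × Fin n → ℝ := fun p => if p.1 = p.2 then c else 0

/-- The matrix identity is paired with `t tᵀ`, turning it into an identity of quadratic forms. -/
theorem exists_decomposition_of_mem_convexHull {n : ℕ} {S : Set (E n)} {c : ℝ}
    (h : scalarArray n c ∈ convexHull ℝ (outerSq '' S)) :
    ∃ (m : ℕ) (w : Fin m → ℝ) (x : Fin m → E n), (∀ i, 0 ≤ w i) ∧ ∑ i, w i = 1 ∧
      (∀ i, x i ∈ S) ∧ ∀ t : E n, ∑ i, w i * (inner ℝ (x i) t) ^ 2 = c * ‖t‖ ^ 2 := by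
  obtain ⟨ι, _, w, z, hw, hw1, hz, hsum⟩ := mem_convexHull_iff_exists_fintype.1 h
  choose x hxS hx using hz
  let e := Fintype.equivFin ι
  refine ⟨Fintype.card ι, w ∘ e.symm, x ∘ e.symm, fun i => hw _, ?_, fun i => hxS _, fun t => ?_⟩
  · rw [← hw1]; exact e.symm.sum_comp w
  · have h1 := e.symm.sum_comp fun i => w i * (inner ℝ (x i) t) ^ 2
    refine h1.trans ?_
    have h2 : ∀ i, w i * (inner ℝ (x i) t) ^ 2 =
        ∑ p : Fin n × Fin n, t p.1 * t p.2 * (w i • z i) p := by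
      intro i
      rw [← hx i, Fintype.sum_prod_type, PiLp.inner_apply, pow_two, Finset.sum_mul_sum,
        Finset.mul_sum]
      refine Finset.sum_congr rfl fun a _ => ?_
      rw [Finset.mul_sum]
      refine Finset.sum_congr rfl fun b _ => ?_
      simp only [outerSq, Pi.smul_apply, smul_eq_mul, RCLike.inner_apply, conj_trivial]
      ring
    simp_rw [h2]
    rw [Finset.sum_comm]
    simp_rw [← Finset.mul_sum, ← Finset.sum_apply, hsum]
    rw [Fintype.sum_prod_type, EuclideanSpace.real_norm_sq_eq, Finset.mul_sum]
    simp only [scalarArray, mul_ite, mul_zero, Finset.sum_ite_eq, Finset.mem_univ, if_true]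
    refine Finset.sum_congr rfl fun a _ => ?_
    ring

/-- A body of volume one in isotropic position carries a finite decomposition of its covariance. -/
theorem IsIsotropicWith.scalarArray_mem {n : ℕ} {K : Set (E n)} (hK : IsSymmConvexBody K)
    (hv : volume K = 1) {c : ℝ} (hc : IsIsotropicWith K c) :
    scalarArray n c ∈ convexHull ℝ (outerSq '' K) := by
  have hcomp : IsCompact (convexHull ℝ (outerSq '' K)) :=
    isCompact_convexHull_of_finiteDimensional (hK.isCompact.image continuous_outerSq)
  have hprob : IsProbabilityMeasure (volume.restrict K) := ⟨by rw [Measure.restrict_apply_univ, hv]⟩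
  have hi : IntegrableOn (outerSq (n := n)) K :=
    continuous_outerSq.continuousOn.integrableOn_compact hK.isCompact
  -- A closed convex set contains the barycentre of any probability measure on it; volume 1 makes
  -- the restriction to `K` such a measure.
  have hmem := (convex_convexHull ℝ (outerSq '' K)).integral_mem hcomp.isClosed
    (f := outerSq) (μ := volume.restrict K)
    ((ae_restrict_iff' hK.measurableSet).2 (Filter.Eventually.of_forall fun x hx =>
      subset_convexHull ℝ _ ⟨x, hx, rfl⟩)) hi
  convert hmem using 1
  ext p
  rw [eval_integral (fun q => hi.eval q)]
  let e := EuclideanSpace.basisFun (Fin n) ℝ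
  have hsq : ∀ θ : E n, IntegrableOn (fun x : E n => (inner ℝ x θ) ^ 2) K := fun θ =>
    (by fun_prop : Continuous fun x : E n => (inner ℝ x θ) ^ 2).continuousOn.integrableOn_compact
      hK.isCompact
  -- Isotropy only controls squares of linear functionals; polarization recovers the off-diagonal
  -- entries.
  have hpol : ∀ x : E n, outerSq x p =
      1 / 4 * ((inner ℝ x (e p.1 + e p.2)) ^ 2 - (inner ℝ x (e p.1 - e p.2)) ^ 2) := by
    intro x
    have : ∀ i, inner ℝ x (e i) = x i := fun i => by
      rw [real_inner_comm]; simp [e, EuclideanSpace.inner_single_left]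
    rw [inner_add_right, inner_sub_right, this, this, outerSq]
    ring
  simp_rw [hpol]
  rw [integral_const_mul, integral_sub (hsq _) (hsq _), hc.eq, hc.eq, norm_add_sq_real,
    norm_sub_sq_real, e.inner_eq_ite, scalarArray]
  split_ifs <;> ring

/-- John's decomposition: `(r² / n) Id` is a convex combination of `x xᵀ` over contact points `x`.
Otherwise some `1 + ε A` with `tr A > 0` would map the body into the ball. -/
theorem IsLownerPosition.scalarArray_mem {n : ℕ} (hn : 1 ≤ n) {K : Set (E n)}
    (hK : IsSymmConvexBody K) {r : ℝ} (hr : 0 < r) (hKr : K ⊆ closedBall (0 : E n) r)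
    (hmin : ∀ S : Set (E n), IsEllipsoid S → K ⊆ S → volume (closedBall (0 : E n) r) ≤ volume S) :
    scalarArray n (r ^ 2 / n) ∈ convexHull ℝ (outerSq '' (K ∩ sphere (0 : E n) r)) := by
  have hn0 : (n : ℝ) ≠ 0 := by exact_mod_cast (by omega : n ≠ 0)
  have hcomp : IsCompact (convexHull ℝ (outerSq '' (K ∩ sphere (0 : E n) r))) :=
    isCompact_convexHull_of_finiteDimensional
      ((hK.isCompact.inter_right isClosed_sphere).image continuous_outerSq)
  by_contra hnot
  obtain ⟨f, u, hfu, hu⟩ :=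
    geometric_hahn_banach_closed_point (convex_convexHull ℝ _) hcomp.isClosed hnot
  -- The matrix of `f` is shifted by `(u / r²) Id`, so that on the sphere of radius `r` its
  -- quadratic form is `f (x xᵀ) - u`. Separation then says: negative at contact points, positive
  -- trace.
  let M : Matrix (Fin n) (Fin n) ℝ := fun i j =>
    f (Pi.single (i, j) 1) - if i = j then u / r ^ 2 else 0
  have hf : ∀ y : Fin n × Fin n → ℝ, f y = ∑ i, ∑ j, y (i, j) * f (Pi.single (i, j) 1) := by
    intro y
    conv_lhs => rw [← Finset.univ_sum_single y]
    rw [map_sum, Fintype.sum_prod_type]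
    refine Finset.sum_congr rfl fun i _ => Finset.sum_congr rfl fun j _ => ?_
    rw [← smul_eq_mul, ← map_smul, ← Pi.single_smul, smul_eq_mul, mul_one]
  have htr : 0 < M.trace := by
    rw [hf] at hu
    simp only [scalarArray, ite_mul, zero_mul, Finset.sum_ite_eq, Finset.mem_univ, if_true,
      ← Finset.mul_sum] at hu
    have : M.trace = (∑ i, f (Pi.single (i, i) 1)) - n * (u / r ^ 2) := by
      have h : M.trace = ∑ i, (f (Pi.single (i, i) 1) - u / r ^ 2) :=
        Finset.sum_congr rfl fun i _ => by change M i i = _; simp [M]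
      simp [h]
    rw [this, sub_pos]
    rw [div_mul_eq_mul_div, lt_div_iff₀ (by positivity)] at hu
    rw [← mul_div_assoc, div_lt_iff₀ (by positivity)]
    linarith
  let A : E n →L[ℝ] E n := Matrix.toEuclideanCLM (𝕜 := ℝ) M
  have hAx : ∀ x : E n, inner ℝ x (A x) = f (outerSq x) - u / r ^ 2 * ‖x‖ ^ 2 := by
    intro x
    rw [hf, PiLp.inner_apply, EuclideanSpace.real_norm_sq_eq, Finset.mul_sum,
      ← Finset.sum_sub_distrib]
    refine Finset.sum_congr rfl fun i _ => ?_
    have : (A x) i = ∑ j, M i j * x j := rfl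
    rw [this]
    simp only [M, sub_mul, Finset.sum_sub_distrib, ite_mul, zero_mul, Finset.sum_ite_eq,
      Finset.mem_univ, if_true, RCLike.inner_apply, conj_trivial, Finset.sum_mul, outerSq]
    congr 1
    · refine Finset.sum_congr rfl fun j _ => ?_
      ring
    · ring
  have hneg : ∀ x ∈ K, ‖x‖ = r → inner ℝ x (A x) < 0 := by
    intro x hx hxr
    rw [hAx, hxr, div_mul_cancel₀ _ (by positivity), sub_neg]
    exact hfu _ (subset_convexHull ℝ _ ⟨x, ⟨hx, mem_sphere_zero_iff_norm.2 hxr⟩, rfl⟩)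
  -- `det (1 + ε M) = 1 + ε tr M + O(ε²)`.
  have hdet : ∀ᶠ ε : ℝ in nhdsWithin 0 (Set.Ioi 0), 1 < (1 + ε • M).det := by
    have hlim : Filter.Tendsto (fun ε : ℝ => M.trace +
        ((1 + (Polynomial.X : Polynomial ℝ) • M.map Polynomial.C).det).divX.divX.eval ε * ε)
        (nhdsWithin 0 (Set.Ioi 0)) (nhds (M.trace + _ * 0)) :=
      ((by fun_prop : Continuous fun ε : ℝ => M.trace +
        ((1 + (Polynomial.X : Polynomial ℝ) • M.map Polynomial.C).det).divX.divX.eval ε * ε).tendsto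
          0).mono_left nhdsWithin_le_nhds
    rw [mul_zero, add_zero] at hlim
    filter_upwards [hlim.eventually (lt_mem_nhds htr), self_mem_nhdsWithin] with ε h1 h2
    rw [Matrix.det_one_add_smul]
    have := mul_pos h1 (Set.mem_Ioi.1 h2)
    nlinarith
  have hin : ∀ᶠ ε : ℝ in nhdsWithin 0 (Set.Ioi 0), ∀ x ∈ K, ‖x + ε • A x‖ ≤ r := by
    -- Compactness makes `ε` uniform over `K`. The repeated `x ∈ K` is needed because the local
    -- claim ranges over a full neighbourhood, which may leave `K`. Off the sphere continuity
    -- suffices; at contact points the first-order term `2 ε ⟨x, A x⟩` is negative.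
    have hev : ∀ᶠ ε : ℝ in nhds 0, ∀ x ∈ K, 0 < ε → x ∈ K → ‖x + ε • A x‖ ≤ r := by
      refine hK.isCompact.eventually_forall_of_forall_eventually fun x hx => ?_
      have hxr : ‖x‖ ≤ r := mem_closedBall_zero_iff.1 (hKr hx)
      rcases hxr.lt_or_eq with hlt | heq
      · have hc : Continuous fun z : ℝ × E n => ‖z.2 + z.1 • A z.2‖ := by fun_prop
        have := (hc.tendsto (0, x)).eventually_lt_const (u := r) (by simpa using hlt)
        filter_upwards [this] with z hz _ _ using hz.le
      · have hc : Continuous fun z : ℝ × E n => 2 * inner ℝ z.2 (A z.2) + z.1 * ‖A z.2‖ ^ 2 := by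
          fun_prop
        have := (hc.tendsto (0, x)).eventually_lt_const (u := 0)
          (by simpa using mul_neg_of_pos_of_neg two_pos (hneg x hx heq))
        filter_upwards [this] with z hz hz0 hzK
        have hzr : ‖z.2‖ ≤ r := mem_closedBall_zero_iff.1 (hKr hzK)
        refine le_of_sq_le_sq ?_ hr.le
        rw [norm_add_sq_real, inner_smul_right, norm_smul, mul_pow, Real.norm_eq_abs, sq_abs]
        nlinarith [mul_neg_of_pos_of_neg hz0 hz, pow_le_pow_left₀ (norm_nonneg _) hzr 2]
    filter_upwards [hev.filter_mono nhdsWithin_le_nhds, self_mem_nhdsWithin] with ε h1 h2 x hx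
    exact h1 x hx h2 hx
  obtain ⟨ε, hε1, hε2⟩ := (hdet.and hin).exists
  let B : E n →L[ℝ] E n := 1 + ε • A
  have hBdet : B.det = (1 + ε • M).det := by
    have : B = Matrix.toEuclideanCLM (𝕜 := ℝ) (1 + ε • M) := by
      rw [map_add, map_one, map_smul]
    rw [this]
    have := LinearMap.det_toLin (EuclideanSpace.basisFun (Fin n) ℝ).toBasis (1 + ε • M)
    rw [← this]
    rfl
  let B' : E n ≃L[ℝ] E n := B.toContinuousLinearEquivOfDetNeZero (by rw [hBdet]; linarith)
  have hB' : (B' : E n →L[ℝ] E n) = B := by ext; rfl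
  -- The ellipsoid `B⁻¹ (r D_n)` contains `K`, yet its volume is smaller than that of `r D_n` by the
  -- factor `det B > 1`.
  let R : E n ≃L[ℝ] E n := (ContinuousLinearEquiv.smulLeft (Units.mk0 r hr.ne')).trans B'.symm
  have hR : ∀ y, R y = B'.symm (r • y) := fun _ => rfl
  have hball : B' '' (R '' closedBall (0 : E n) 1) = closedBall (0 : E n) r := by
    rw [Set.image_image]
    simp only [hR, ContinuousLinearEquiv.apply_symm_apply]
    ext y
    simp only [Set.mem_image, mem_closedBall_zero_iff]
    constructor
    · rintro ⟨x, hx, rfl⟩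
      rw [norm_smul, Real.norm_of_nonneg hr.le]
      exact mul_le_of_le_one_right hr.le hx
    · intro hy
      refine ⟨r⁻¹ • y, ?_, by rw [smul_smul, mul_inv_cancel₀ hr.ne', one_smul]⟩
      rw [norm_smul, norm_inv, Real.norm_of_nonneg hr.le, ← div_eq_inv_mul]
      exact div_le_one_of_le₀ hy hr.le
  have hsub : K ⊆ R '' closedBall (0 : E n) 1 := by
    intro x hx
    rw [← B'.injective.mem_set_image, hball, mem_closedBall_zero_iff]
    exact hε2 x hx
  have hle := hmin _ ⟨R, rfl⟩ hsub
  have hvol := volume_image (R '' closedBall (0 : E n) 1) B'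
  rw [hball, hB', hBdet, abs_of_pos (by linarith)] at hvol
  have hfin : volume (R '' closedBall (0 : E n) 1) ≠ ⊤ :=
    ((isCompact_closedBall (0 : E n) 1).image R.continuous).measure_lt_top.ne
  have hpos : volume (R '' closedBall (0 : E n) 1) ≠ 0 := fun h => by
    rw [h, mul_zero] at hvol
    exact (measure_closedBall_pos volume (0 : E n) hr).ne' hvol
  have hlt : 1 * volume (R '' closedBall (0 : E n) 1) <
      ENNReal.ofReal (1 + ε • M).det * volume (R '' closedBall (0 : E n) 1) :=
    ENNReal.mul_lt_mul_left hpos hfin (by simpa using hε1)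
  rw [one_mul, ← hvol] at hlt
  exact absurd hle (not_le.2 hlt)

/-! ### The isotropic constant of a body inside a ball -/

/-- AM-GM in logarithmic form, from `log a ≤ a - 1`. -/
theorem card_le_sum_of_one_le_prod {n : ℕ} {a : Fin n → ℝ} (ha : ∀ i, 0 < a i)
    (h : 1 ≤ ∏ i, a i) : (n : ℝ) ≤ ∑ i, a i := by
  have h1 : 0 ≤ ∑ i, Real.log (a i) := by
    rw [← Real.log_prod (fun i _ => (ha i).ne')]
    exact Real.log_nonneg h
  have h2 : ∑ i, Real.log (a i) ≤ ∑ i, (a i - 1) :=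
    Finset.sum_le_sum fun i _ => Real.log_le_sub_one_of_pos (ha i)
  simp only [Finset.sum_sub_distrib, Finset.sum_const, Finset.card_univ, Fintype.card_fin,
    nsmul_eq_mul, mul_one] at h2
  linarith

/-- Hadamard's inequality and the arithmetic-geometric mean inequality bound the Hilbert-Schmidt
norm of a volume preserving map from below. -/
theorem card_le_sum_norm_sq_of_abs_det_eq_one {n : ℕ} {S : E n →L[ℝ] E n} (hS : |S.det| = 1) :
    (n : ℝ) ≤ ∑ i, ‖S (EuclideanSpace.basisFun (Fin n) ℝ i)‖ ^ 2 := by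
  let e := EuclideanSpace.basisFun (Fin n) ℝ
  have : Fact (Module.finrank ℝ (E n) = n) := ⟨by simp⟩
  have hdet : |e.toBasis.det fun i => S (e i)| = 1 := by
    have h := e.toBasis.det_comp (S : E n →ₗ[ℝ] E n) e.toBasis
    rw [e.toBasis.det_self, mul_one] at h
    rw [← hS]
    congr 1
  have hH : 1 ≤ ∏ i, ‖S (e i)‖ := by
    rw [← hdet]
    have h := (e.toBasis.orientation).abs_volumeForm_apply_le fun i => S (e i)
    rwa [Orientation.volumeForm_robust _ e rfl] at h
  have hprod : 1 ≤ ∏ i, ‖S (e i)‖ ^ 2 := by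
    rw [Finset.prod_pow]
    exact one_le_pow₀ hH
  refine card_le_sum_of_one_le_prod (fun i => ?_) hprod
  refine (sq_nonneg _).lt_of_ne' fun h0 => ?_
  rw [Finset.prod_eq_zero (Finset.mem_univ i) h0] at hprod
  linarith

/-- Transporting moments from isotropic position gives `∫_K |x|² = ℓ² ‖A‖²_HS` with `|det A| = 1`,
which is at least `n ℓ²`; containment in the ball bounds it by `r²`. -/
theorem HasIsotropicConstant.sqrt_mul_le {n : ℕ} {K : Set (E n)} (hK : IsSymmConvexBody K)
    (hv : volume K = 1) {ℓ : ℝ} (hℓ : HasIsotropicConstant K ℓ) {r : ℝ} (hr : 0 ≤ r)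
    (hKr : K ⊆ closedBall (0 : E n) r) : √(n : ℝ) * ℓ ≤ r := by
  obtain ⟨h0, T, hTv, hTi⟩ := hℓ
  let e := EuclideanSpace.basisFun (Fin n) ℝ
  let A : E n →L[ℝ] E n := ContinuousLinearMap.adjoint (T.symm : E n →L[ℝ] E n)
  have hback : T.symm '' (T '' K) = K := by rw [Set.image_image]; simp
  have hdet : |(T.symm : E n →L[ℝ] E n).det| = 1 := by
    have := volume_image (T '' K) T.symm
    rw [hback, hv, hTv, mul_one] at this
    exact ENNReal.ofReal_eq_one.1 this.symm
  have hAdet : |A.det| = 1 := by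
    rw [← hdet]
    congr 1
    simp only [A, ContinuousLinearMap.det]
    rw [← LinearMap.det_toMatrix e.toBasis, ← LinearMap.det_toMatrix e.toBasis]
    have h2 := LinearMap.toMatrix_adjoint e e ((T.symm : E n →L[ℝ] E n) : E n →ₗ[ℝ] E n)
    have h3 : ((ContinuousLinearMap.adjoint (T.symm : E n →L[ℝ] E n) : E n →L[ℝ] E n) :
        E n →ₗ[ℝ] E n) = LinearMap.adjoint ((T.symm : E n →L[ℝ] E n) : E n →ₗ[ℝ] E n) := rfl
    rw [h3, h2, Matrix.det_conjTranspose]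
    simp
  have hmom : ∀ θ : E n, ∫ x in K, (inner ℝ x θ) ^ 2 = ℓ ^ 2 * ‖A θ‖ ^ 2 := by
    intro θ
    rw [← hTi.eq, ← hback, setIntegral_sq_image (hK.image T).measurableSet, hdet, one_mul, hback]
  have hi : ∀ θ : E n, IntegrableOn (fun x : E n => (inner ℝ x θ) ^ 2) K := fun θ =>
    (by fun_prop : Continuous fun x : E n => (inner ℝ x θ) ^ 2).continuousOn.integrableOn_compact
      hK.isCompact
  have hsum : ∫ x in K, ‖x‖ ^ 2 = ℓ ^ 2 * ∑ i, ‖A (e i)‖ ^ 2 := by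
    rw [Finset.mul_sum]
    simp_rw [← hmom]
    rw [← integral_finsetSum _ fun i _ => hi (e i)]
    simp_rw [e.sum_sq_inner_left]
  have hle : ∫ x in K, ‖x‖ ^ 2 ≤ r ^ 2 := by
    have h1 : ∫ x in K, ‖x‖ ^ 2 ≤ ∫ _ in K, r ^ 2 := by
      refine setIntegral_mono_on ?_ ?_ hK.measurableSet fun x hx =>
        pow_le_pow_left₀ (norm_nonneg _) (mem_closedBall_zero_iff.1 (hKr hx)) 2
      · exact (by fun_prop : Continuous fun x : E n => ‖x‖ ^ 2).continuousOn.integrableOn_compact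
          hK.isCompact
      · exact continuousOn_const.integrableOn_compact hK.isCompact
    rwa [setIntegral_const, measureReal_def, hv, ENNReal.toReal_one, one_smul] at h1
  have hn := card_le_sum_norm_sq_of_abs_det_eq_one hAdet
  refine le_of_sq_le_sq ?_ hr
  rw [mul_pow, Real.sq_sqrt (Nat.cast_nonneg n)]
  calc (n : ℝ) * ℓ ^ 2 ≤ (∑ i, ‖A (e i)‖ ^ 2) * ℓ ^ 2 := by gcongr
    _ = ∫ x in K, ‖x‖ ^ 2 := by rw [hsum, mul_comm]
    _ ≤ r ^ 2 := hle

/-! ### The bounds on the isotropic constant -/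

theorem isotropicConstant_le_typeTwoConstant_mul_volRatio {n : ℕ} (hn : 1 ≤ n) {K L : Set (E n)}
    (hK : IsSymmConvexBody K) (hL : IsSymmConvexBody L) (hKL : K ⊆ L) :
    isotropicConstant K ≤ 2 * (typeTwoConstant L * volRatio L K) := by
  obtain ⟨h0, T, hTv, hTi⟩ := hasIsotropicConstant_isotropicConstant hn hK
  set ℓ := isotropicConstant K
  obtain ⟨m, w, x, hw, hw1, hx, hcov⟩ :=
    exists_decomposition_of_mem_convexHull (hTi.scalarArray_mem (hK.image T) hTv)
  have hTL := hL.image T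
  set J := √(∫ y, gauge (T '' L) y ^ 2 ∂(stdGaussian (E n)))
  have h1 : ℓ * J ≤ typeTwoConstant L := hL.le_typeTwoConstant fun t ht hty =>
    (hty.image T).mul_sqrt_le hTL ht.le hw hw1
      (fun i => gauge_le_one_of_mem (Set.image_mono hKL (hx i))) h0 hcov
  -- The ratio is invariant under `T`, and `T K` has volume 1.
  have hratio : volRatio L K = volume.real (T '' L) ^ (1 / (n : ℝ)) := by
    unfold volRatio
    congr 1
    have hk : volume.real (T '' K) = |(T : E n →L[ℝ] E n).det| * volume.real K := by
      rw [measureReal_def, volume_image, ENNReal.toReal_mul, ENNReal.toReal_ofReal (abs_nonneg _)]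
      rfl
    have hl : volume.real (T '' L) = |(T : E n →L[ℝ] E n).det| * volume.real L := by
      rw [measureReal_def, volume_image, ENNReal.toReal_mul, ENNReal.toReal_ofReal (abs_nonneg _)]
      rfl
    rw [measureReal_def, hTv, ENNReal.toReal_one] at hk
    have hk0 : volume.real K ≠ 0 := fun h => by rw [h, mul_zero] at hk; exact one_ne_zero hk
    rw [hl, div_eq_iff hk0, mul_right_comm, ← hk, one_mul]
  have h2 := hTL.one_le_volume_rpow_mul_sqrt_integral hn
  rw [← hratio] at h2
  have hr0 : 0 ≤ volRatio L K := by rw [hratio]; positivity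
  calc ℓ ≤ ℓ * (2 * (volRatio L K * J)) := le_mul_of_one_le_right h0 h2
    _ = 2 * (ℓ * J * volRatio L K) := by ring
    _ ≤ 2 * (typeTwoConstant L * volRatio L K) := by gcongr

/-- Allows the denominator in the second bound to be cleared. -/
theorem IsSymmConvexBody.sqrt_mul_meanNormTwo_pos {n : ℕ} (hn : 1 ≤ n) {K : Set (E n)}
    (hK : IsSymmConvexBody K) : 0 < √(n : ℝ) * meanNormTwo K := by
  rw [← sqrt_integral_gauge_sq_eq hn]
  refine (Real.sqrt_nonneg _).lt_of_ne' fun h => ?_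
  have := hK.one_le_volume_rpow_mul_sqrt_integral hn
  rw [h, mul_zero, mul_zero] at this
  linarith

theorem isotropicConstant_le_of_isIsotropicPosition {n : ℕ} (hn : 1 ≤ n) {K : Set (E n)}
    (hK : IsSymmConvexBody K) (hv : volume K = 1) (h : IsIsotropicPosition K) :
    isotropicConstant K ≤ typeTwoConstant K / (√(n : ℝ) * meanNormTwo K) := by
  obtain ⟨c, hc⟩ := h
  have hc0 : 0 ≤ c := by
    rw [← hc (EuclideanSpace.single ⟨0, hn⟩ 1) (by simp)]
    exact integral_nonneg fun x => sq_nonneg _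
  -- Here `K` is its own isotropic position, so `√c` is its isotropic constant.
  have hid : HasIsotropicConstant K (√c) :=
    ⟨Real.sqrt_nonneg c, ContinuousLinearEquiv.refl ℝ (E n), by simpa using hv, by
      simpa [Real.sq_sqrt hc0] using hc⟩
  refine (hasIsotropicConstant_le hn hK (hasIsotropicConstant_isotropicConstant hn hK) hid).trans ?_
  obtain ⟨m, w, x, hw, hw1, hx, hcov⟩ :=
    exists_decomposition_of_mem_convexHull (hc.scalarArray_mem hK hv)
  rw [le_div_iff₀ (hK.sqrt_mul_meanNormTwo_pos hn), ← sqrt_integral_gauge_sq_eq hn]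
  exact hK.le_typeTwoConstant fun t ht hty => hty.mul_sqrt_le hK ht.le hw hw1
    (fun i => gauge_le_one_of_mem (hx i)) (Real.sqrt_nonneg c)
    (fun t => by rw [hcov t, Real.sq_sqrt hc0])

theorem isotropicConstant_le_of_isLownerPosition {n : ℕ} (hn : 1 ≤ n) {K : Set (E n)}
    (hK : IsSymmConvexBody K) (hv : volume K = 1) (h : IsLownerPosition K) :
    isotropicConstant K ≤ typeTwoConstant K / (√(n : ℝ) * meanNormTwo K) := by
  obtain ⟨r, hr, hKr, hmin⟩ := h
  have hn0 : (0 : ℝ) < n := by exact_mod_cast hn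
  have hle := (hasIsotropicConstant_isotropicConstant hn hK).sqrt_mul_le hK hv hr.le hKr
  obtain ⟨m, w, x, hw, hw1, hx, hcov⟩ := exists_decomposition_of_mem_convexHull
    (IsLownerPosition.scalarArray_mem hn hK hr hKr hmin)
  rw [le_div_iff₀ (hK.sqrt_mul_meanNormTwo_pos hn), ← sqrt_integral_gauge_sq_eq hn]
  -- `r / √n` is the meeting point: it bounds `L_K` from above and is the scale `s` in John's
  -- decomposition.
  refine (mul_le_mul_of_nonneg_right (c := r / √(n : ℝ)) ?_ (Real.sqrt_nonneg _)).trans ?_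
  · rwa [le_div_iff₀ (Real.sqrt_pos.2 hn0), mul_comm]
  · exact hK.le_typeTwoConstant fun t ht hty => hty.mul_sqrt_le hK ht.le hw hw1
      (fun i => gauge_le_one_of_mem (hx i).1) (by positivity)
      (fun t => by rw [hcov t, div_pow, Real.sq_sqrt hn0.le])

end SlicingType2

theorem theorem1 :
    ∃ C : ℝ, 0 < C ∧ ∀ (n : ℕ), 1 ≤ n → ∀ K : Set (E n), IsSymmConvexBody K →
      isotropicConstant K ≤
          C * sInf {r : ℝ | ∃ L : Set (E n), IsSymmConvexBody L ∧ K ⊆ L ∧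
            r = typeTwoConstant L * volRatio L K} ∧
      (volume K = 1 → (IsLownerPosition K ∨ IsIsotropicPosition K) →
        isotropicConstant K ≤ C * (typeTwoConstant K / (√(n : ℝ) * meanNormTwo K))) := by
  -- The 2 comes from the volume estimate. The second bound holds with constant 1, and `L_K ≥ 0`
  -- lets it be weakened.
  refine ⟨2, two_pos, fun n hn K hK => ⟨?_, fun hv hpos => ?_⟩⟩
  · rw [← div_le_iff₀' two_pos]
    refine le_csInf ⟨_, K, hK, subset_rfl, rfl⟩ ?_
    rintro _ ⟨L, hL, hKL, rfl⟩
    rw [div_le_iff₀' two_pos]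
    exact isotropicConstant_le_typeTwoConstant_mul_volRatio hn hK hL hKL
  · have h : isotropicConstant K ≤ typeTwoConstant K / (√(n : ℝ) * meanNormTwo K) :=
      hpos.elim (isotropicConstant_le_of_isLownerPosition hn hK hv)
        (isotropicConstant_le_of_isIsotropicPosition hn hK hv)
    have h0 := (hasIsotropicConstant_isotropicConstant hn hK).1
    linarith
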